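/- Let $F$ be an algebraically closed field of characteristic different from $2$, let $G$ be a group of order $8$, and let $n\ge 0$ be an integer. A representation of $G$ of degree $n$ over $F$ is a homomorphism $G\to GL(V)$ with $V$ an $F$-vector space of dimension $n$; two representations are isomorphic if there is a $G$-equivariant linear isomorphism between their spaces. The number of isomorphism classes of representations of $G$ of degree $n$ over $F$ is finite, and it equals $$\binom{n+7}{7}\quad\text{if } G \text{ is abelian},\qquad \sum_{s=0}^{\lfloor n/2\rfloor}\binom{n-2s+3}{3}\quad\text{if } G \text{ is not abelian}.$$ Moreover, if $G$ is not abelian, then $G$ has, up to isomorphism, exactly five irreducible finite-dimensional representations over $F$, and their degrees are $1,1,1,1,2$. -/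

import Mathlib

universe u v

/-- A finite-dimensional representation of the group `G` over the field `F`: a finite-dimensional
`F`-vector space `V` together with a homomorphism from `G` to the linear automorphisms of `V`
(a monoid homomorphism from a group to `End V` automatically has invertible values). -/
structure FinRep (F : Type u) (G : Type v) [Field F] [Group G] where
  V : Type u
  [addCommGroup : AddCommGroup V]
  [module : Module F V]
  [finiteDimensional : FiniteDimensional F V]
  ρ : Representation F G V

namespace FinRep

attribute [instance] addCommGroup module finiteDimensional

variable {F : Type u} {G : Type v} [Field F] [Group G]

/-- The degree of a representation is the dimension of its space. -/
noncomputable def degree (σ : FinRep F G) : ℕ := Module.finrank F σ.V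

/-- Isomorphism of representations: there is a `G`-equivariant linear isomorphism. -/
def Iso (σ τ : FinRep F G) : Prop := Nonempty (Representation.Equiv σ.ρ τ.ρ)

/-- Irreducibility: the space is nonzero and its only invariant subspaces are `0` and itself. -/
def Irreducible (σ : FinRep F G) : Prop := Representation.IsIrreducible σ.ρ

/-- Isomorphism, as an equivalence relation on the representations of degree `n`. -/
def isoSetoid (F : Type u) (G : Type v) [Field F] [Group G] (n : ℕ) :
    Setoid {σ : FinRep F G // σ.degree = n} where
  r σ τ := Iso σ.1 τ.1
  iseqv :=
    { refl := fun σ => ⟨Representation.Equiv.refl σ.1.ρ⟩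
      symm := fun ⟨e⟩ => ⟨e.symm⟩
      trans := fun ⟨e⟩ ⟨f⟩ => ⟨e.trans f⟩ }

/-- The isomorphism classes of representations of `G` over `F` of degree `n`. -/
def IsoClasses (F : Type u) (G : Type v) [Field F] [Group G] (n : ℕ) : Type (max (u + 1) v) :=
  Quotient (isoSetoid F G n)

end FinRep

/-! As 8 is invertible in `F`, Maschke's theorem makes the group algebra semisimple. By Schur's
lemma the multiplicity of an irreducible σᵢ in τ is the dimension of Hom(τ, σᵢ), so classes of
degree n correspond to solutions of ∑ mᵢ dᵢ = n (`nonempty_isoClasses_equiv`), counted by stars and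
bars.

To find the irreducibles, decompose the regular module: pairwise non-isomorphic ones satisfy ∑ dᵢ² ≤
|G| (`sum_degree_sq_le`), and equality leaves no room for another. In the abelian case eight linear
characters attain the bound. Otherwise the abelianization has order 4, giving four characters, and
some irreducible has degree d ≠ 1 because the regular representation is faithful; then 4 + d² ≤ 8
forces d = 2, and the bound is attained. -/

open Module MonoidAlgebra

/-! ### Homomorphism spaces of semisimple modules -/

section Modules

variable (F : Type*) [Field F] {A : Type*} [Ring A] [Algebra F A]

/-- The space of homomorphisms out of a finite product has the sum of the dimensions. -/
theorem finrank_pi_linearMap {ι : Type*} [Fintype ι] (T : ι → Type*) [∀ j, AddCommGroup (T j)]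
    [∀ j, Module F (T j)] [∀ j, Module A (T j)] [∀ j, IsScalarTower F A (T j)]
    [∀ j, FiniteDimensional F (T j)] (S : Type*) [AddCommGroup S] [Module F S] [Module A S]
    [IsScalarTower F A S] [FiniteDimensional F S] :
    finrank F ((Π j, T j) →ₗ[A] S) = ∑ j, finrank F (T j →ₗ[A] S) := by
  classical
  have (j : ι) : Module.Finite F (T j →ₗ[A] S) :=
    .of_injective (LinearMap.restrictScalarsₗ F A (T j) S F) (LinearMap.restrictScalars_injective _)
  rw [← finrank_pi_fintype, (LinearMap.lsum A T F).finrank_eq]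

theorem finrank_linearMap_congr {M N S : Type*} [AddCommGroup M] [Module A M]
    [AddCommGroup N] [Module A N] [AddCommGroup S] [Module F S] [Module A S]
    [IsScalarTower F A S] (e : M ≃ₗ[A] N) :
    finrank F (M →ₗ[A] S) = finrank F (N →ₗ[A] S) :=
  LinearEquiv.finrank_eq
    { toFun f := f ∘ₗ e.symm.toLinearMap
      invFun f := f ∘ₗ e.toLinearMap
      map_add' _ _ := rfl
      map_smul' _ _ := rfl
      left_inv f := by ext; simp
      right_inv f := by ext; simp }

open scoped Classical in
/-- **Schur's lemma** in terms of dimensions. -/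
theorem finrank_linearMap_simple [IsAlgClosed F] (T S : Type*) [AddCommGroup T] [Module F T]
    [Module A T] [IsScalarTower F A T] [AddCommGroup S] [Module F S] [Module A S]
    [IsScalarTower F A S] [FiniteDimensional F S] [IsSimpleModule A T] [IsSimpleModule A S] :
    finrank F (T →ₗ[A] S) = if Nonempty (T ≃ₗ[A] S) then 1 else 0 := by
  split_ifs with h
  · obtain ⟨e⟩ := h
    rw [finrank_linearMap_congr F e]
    have : Function.Bijective (algebraMap F (Module.End A S)) :=
      IsSimpleModule.algebraMap_end_bijective_of_isAlgClosed F
    rw [← (LinearEquiv.ofBijective (Algebra.linearMap F (Module.End A S)) this).finrank_eq,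
      finrank_self]
  · have : Subsingleton (T →ₗ[A] S) := subsingleton_of_forall_eq 0 fun f =>
      (LinearMap.bijective_or_eq_zero f).resolve_left fun hf => h ⟨.ofBijective f hf⟩
    exact finrank_zero_of_subsingleton

/-- A finite-dimensional semisimple module is a finite product of simple submodules. -/
theorem exists_linearEquiv_pi_simple (M : Type*) [AddCommGroup M] [Module F M] [Module A M]
    [IsScalarTower F A M] [FiniteDimensional F M] [IsSemisimpleModule A M] :
    ∃ (n : ℕ) (T : Fin n → Submodule A M), Nonempty (M ≃ₗ[A] Π j, T j) ∧
      ∀ j, IsSimpleModule A (T j) := by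
  have : Module.Finite A M := .of_restrictScalars_finite F A M
  obtain ⟨n, T, e, h⟩ := IsSemisimpleModule.exists_linearEquiv_fin_dfinsupp A M
  exact ⟨n, T, ⟨e.trans (DFinsupp.linearEquivFunOnFintype)⟩, h⟩

end Modules

/-! ### Multiplicities of simple modules -/

section Simples

variable (F : Type*) [Field F] {A : Type*} [Ring A] [Algebra F A]
  {ι : Type*} (S : ι → Type*) [∀ i, AddCommGroup (S i)]
  [∀ i, Module F (S i)] [∀ i, Module A (S i)] [∀ i, IsScalarTower F A (S i)]
  [∀ i, FiniteDimensional F (S i)] [∀ i, IsSimpleModule A (S i)]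

/-- The multiplicities of pairwise non-isomorphic simple modules are dimensions of spaces of
homomorphisms. -/
theorem finrank_pi_sigma_linearMap [IsAlgClosed F] [Finite ι]
    (hS : ∀ i j, Nonempty (S i ≃ₗ[A] S j) → i = j) (m : ι → ℕ) (i : ι) :
    finrank F ((Π x : Σ i, Fin (m i), S x.1) →ₗ[A] S i) = m i := by
  classical
  have := Fintype.ofFinite ι
  have key (j : ι) : finrank F (S j →ₗ[A] S i) = if j = i then 1 else 0 := by
    rw [finrank_linearMap_simple]
    exact if_congr ⟨hS j i, fun h => h ▸ ⟨.refl _ _⟩⟩ rfl rfl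
  rw [finrank_pi_linearMap F (fun x : Σ i, Fin (m i) => S x.1), Fintype.sum_sigma]
  simp [key]

omit [∀ i, Module F (S i)] [∀ i, IsScalarTower F A (S i)] [∀ i, FiniteDimensional F (S i)]
  [∀ i, IsSimpleModule A (S i)] in
/-- A finite-dimensional semisimple module is a product of members of a complete family of simple
modules. -/
theorem exists_linearEquiv_pi_sigma [Finite ι] (M : Type*) [AddCommGroup M] [Module F M]
    [Module A M] [IsScalarTower F A M] [FiniteDimensional F M] [IsSemisimpleModule A M]
    (hS : ∀ T : Submodule A M, IsSimpleModule A T → ∃ i, Nonempty (T ≃ₗ[A] S i)) :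
    ∃ m : ι → ℕ, Nonempty (M ≃ₗ[A] Π x : Σ i, Fin (m i), S x.1) := by
  classical
  obtain ⟨n, T, ⟨e⟩, hT⟩ := exists_linearEquiv_pi_simple F (A := A) M
  choose f hf using fun j => hS (T j) (hT j)
  -- The multiplicity of `S i` is the size of the fibre of `f` over `i`; `g` regroups the summands
  -- by fibre.
  let g : (Σ i, Fin (Fintype.card {j // f j = i})) ≃ Fin n :=
    (Equiv.sigmaCongrRight fun i => (Fintype.equivFin {j // f j = i}).symm).trans
      (Equiv.sigmaFiberEquiv f)
  have hg (x) : f (g x) = x.1 := ((Fintype.equivFin {j // f j = x.1}).symm x.2).2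
  have hc {i j : ι} (h : i = j) : Nonempty (S i ≃ₗ[A] S j) := h ▸ ⟨.refl _ _⟩
  refine ⟨fun i => Fintype.card {j // f j = i},
    ⟨e.trans ((LinearEquiv.piCongrLeft A (fun j => T j) g).symm.trans
    (LinearEquiv.piCongrRight fun x => (hf (g x)).some.trans (hc (hg x)).some))⟩⟩

/-- The squares of the degrees of pairwise non-isomorphic simple modules add up to at most the
dimension of the algebra. -/
theorem sum_finrank_sq_le [IsAlgClosed F] [Fintype ι] [FiniteDimensional F A] [IsSemisimpleRing A]
    (hS : ∀ i j, Nonempty (S i ≃ₗ[A] S j) → i = j) :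
    ∑ i, finrank F (S i) ^ 2 ≤ finrank F A := by
  classical
  obtain ⟨n, T, ⟨e⟩, hT⟩ := exists_linearEquiv_pi_simple F (A := A) A
  -- Since Hom(A, S) ≅ S, the degree of `S i` is its multiplicity in the regular module.
  have hd (i : ι) : finrank F (S i) = ∑ j, if Nonempty (T j ≃ₗ[A] S i) then 1 else 0 := by
    rw [← (LinearMap.ringLmapEquivSelf A F (S i)).finrank_eq, finrank_linearMap_congr F e]
    simp only [finrank_pi_linearMap F (A := A) (fun j => T j) (S i), finrank_linearMap_simple]
  calc ∑ i, finrank F (S i) ^ 2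
      = ∑ i, ∑ j, if Nonempty (T j ≃ₗ[A] S i) then finrank F (T j) else 0 := by
        refine Finset.sum_congr rfl fun i _ => ?_
        rw [sq]
        nth_rw 1 [hd i]
        rw [Finset.sum_mul]
        refine Finset.sum_congr rfl fun j _ => ?_
        split_ifs with h
        · rw [one_mul, (h.some.restrictScalars F).finrank_eq]
        · rw [zero_mul]
    _ = ∑ j, ∑ i, if Nonempty (T j ≃ₗ[A] S i) then finrank F (T j) else 0 := Finset.sum_comm
    _ ≤ ∑ j, finrank F (T j) := by
        refine Finset.sum_le_sum fun j _ => ?_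
        rw [← Finset.sum_filter, Finset.sum_const, smul_eq_mul]
        refine (Nat.mul_le_mul_right _
          (Finset.card_le_one.2 fun i hi i' hi' => ?_)).trans_eq (one_mul _)
        obtain ⟨e₁⟩ := (Finset.mem_filter.1 hi).2
        obtain ⟨e₂⟩ := (Finset.mem_filter.1 hi').2
        exact hS i i' ⟨e₁.symm.trans e₂⟩
    _ = finrank F A := by
        rw [(e.restrictScalars F).finrank_eq, finrank_pi_fintype]

end Simples

/-! ### Representations as modules over the group algebra -/

namespace FinRep
variable {F : Type u} {G : Type v} [Field F] [Group G]

/-- The module over the group algebra attached to a representation. -/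
abbrev Mod (σ : FinRep F G) : Type u := σ.ρ.asModule

instance (σ : FinRep F G) : FiniteDimensional F σ.Mod := σ.finiteDimensional

theorem finrank_mod (σ : FinRep F G) : finrank F σ.Mod = σ.degree :=
  σ.ρ.asModuleEquiv.finrank_eq

theorem iso_iff (σ τ : FinRep F G) : σ.Iso τ ↔ Nonempty (σ.Mod ≃ₗ[MonoidAlgebra F G] τ.Mod) := by
  constructor
  · rintro ⟨e⟩
    exact ⟨.ofBijective (Representation.IntertwiningMap.equivLinearMapAsModule σ.ρ τ.ρ e.toIntertwiningMap)
      e.toLinearEquiv.bijective⟩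
  · rintro ⟨e⟩
    exact ⟨((Representation.IntertwiningMap.equivLinearMapAsModule σ.ρ τ.ρ).symm
      e.toLinearMap).ofBijective e.bijective⟩

theorem Iso.degree_eq {σ τ : FinRep F G} (h : σ.Iso τ) : σ.degree = τ.degree := by
  obtain ⟨e⟩ := h
  exact e.toLinearEquiv.finrank_eq

theorem irreducible_iff (σ : FinRep F G) :
    σ.Irreducible ↔ IsSimpleModule (MonoidAlgebra F G) σ.Mod :=
  Representation.irreducible_iff_isSimpleModule_asModule σ.ρ

/-- Every finite-dimensional module over the group algebra, in any universe, comes from a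
representation. -/
theorem exists_mod_linearEquiv (M : Type*) [AddCommGroup M] [Module F M]
    [Module (MonoidAlgebra F G) M] [IsScalarTower F (MonoidAlgebra F G) M] [FiniteDimensional F M] :
    ∃ σ : FinRep F G, Nonempty (σ.Mod ≃ₗ[MonoidAlgebra F G] M) := by
  -- Coordinates move `M` into the universe of `F`, as `FinRep` demands.
  let e : M ≃ₗ[F] (Fin (finrank F M) → F) := (finBasis F M).equivFun
  let ρ : Representation F G (Fin (finrank F M) → F) :=
    (MonoidHomClass.toMonoidHom (e.conjAlgEquiv F)).comp
      ((MonoidHomClass.toMonoidHom (Algebra.lsmul F F M (A := MonoidAlgebra F G))).comp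
        (MonoidAlgebra.of F G))
  let σ : FinRep F G := { V := Fin (finrank F M) → F, ρ := ρ }
  let f : σ.Mod →ₗ[F] M := e.symm.toLinearMap ∘ₗ σ.ρ.asModuleEquiv.toLinearMap
  refine ⟨σ, ⟨.ofBijective (MonoidAlgebra.equivariantOfLinearOfComm f fun g v => ?_) ?_⟩⟩
  · simp [f, σ, ρ]
    exact e.symm_apply_apply _
  · exact (σ.ρ.asModuleEquiv.trans e.symm).bijective

section Classification

variable [IsAlgClosed F] [Finite G] [NeZero (Nat.card G : F)] {ι : Type*} [Fintype ι]
  {σ : ι → FinRep F G}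

/-- The multiplicity of `σ` in `τ`, for irreducible `σ`. -/
noncomputable def mult (τ σ : FinRep F G) : ℕ :=
  finrank F (τ.Mod →ₗ[MonoidAlgebra F G] σ.Mod)

omit [IsAlgClosed F] [Finite G] [NeZero (Nat.card G : F)] in
theorem mult_congr {τ τ' : FinRep F G} (h : τ.Iso τ') (σ : FinRep F G) : τ.mult σ = τ'.mult σ :=
  finrank_linearMap_congr F ((iso_iff _ _).1 h).some

omit [Finite G] [NeZero (Nat.card G : F)] in
theorem mult_eq (hirr : ∀ i, (σ i).Irreducible) (hinj : ∀ i j, (σ i).Iso (σ j) → i = j)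
    {τ : FinRep F G} {m : ι → ℕ}
    (e : τ.Mod ≃ₗ[MonoidAlgebra F G] Π x : Σ i, Fin (m i), (σ x.1).Mod) (i : ι) :
    τ.mult (σ i) = m i := by
  have _ (i : ι) : IsSimpleModule (MonoidAlgebra F G) (σ i).Mod := (irreducible_iff _).1 (hirr i)
  rw [mult, finrank_linearMap_congr F e]
  exact finrank_pi_sigma_linearMap F (fun i => (σ i).Mod)
    (fun i j h => hinj i j ((iso_iff _ _).2 h)) m i

omit [IsAlgClosed F] [Finite G] [NeZero (Nat.card G : F)] in
theorem degree_eq_sum {τ : FinRep F G} {m : ι → ℕ}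
    (e : τ.Mod ≃ₗ[MonoidAlgebra F G] Π x : Σ i, Fin (m i), (σ x.1).Mod) :
    ∑ i, m i * (σ i).degree = τ.degree := by
  rw [← finrank_mod τ, (e.restrictScalars F).finrank_eq, finrank_pi_fintype, Fintype.sum_sigma]
  simp [finrank_mod]

omit [IsAlgClosed F] in
theorem exists_linearEquiv (hcomp : ∀ τ : FinRep F G, τ.Irreducible → ∃ i, τ.Iso (σ i))
    (τ : FinRep F G) : ∃ m : ι → ℕ,
      Nonempty (τ.Mod ≃ₗ[MonoidAlgebra F G] Π x : Σ i, Fin (m i), (σ x.1).Mod) := by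
  refine exists_linearEquiv_pi_sigma F (fun i => (σ i).Mod) τ.Mod fun T hT => ?_
  have : FiniteDimensional F T :=
    .of_injective (T.subtype.restrictScalars F) Subtype.val_injective
  obtain ⟨τ', ⟨e⟩⟩ := exists_mod_linearEquiv (F := F) (G := G) T
  obtain ⟨i, hi⟩ := hcomp τ' ((irreducible_iff _).2 (.congr e))
  exact ⟨i, ⟨e.symm.trans ((iso_iff _ _).1 hi).some⟩⟩

/-- Representations of degree `n` are classified by the multiplicities of the irreducible ones. -/
theorem nonempty_isoClasses_equiv (hirr : ∀ i, (σ i).Irreducible)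
    (hinj : ∀ i j, (σ i).Iso (σ j) → i = j)
    (hcomp : ∀ τ : FinRep F G, τ.Irreducible → ∃ i, τ.Iso (σ i)) (n : ℕ) :
    Nonempty (IsoClasses F G n ≃ {m : ι → ℕ // ∑ i, m i * (σ i).degree = n}) := by
  let f : IsoClasses F G n → {m : ι → ℕ // ∑ i, m i * (σ i).degree = n} :=
    Quotient.lift (fun τ => ⟨fun i => τ.1.mult (σ i), by
      obtain ⟨m, ⟨e⟩⟩ := exists_linearEquiv hcomp τ.1
      simp only [mult_eq hirr hinj e, degree_eq_sum e, τ.2]⟩)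
      fun τ τ' h => Subtype.ext (funext fun i => mult_congr h (σ i))
  refine ⟨.ofBijective f ⟨?_, ?_⟩⟩
  · rintro ⟨τ⟩ ⟨τ'⟩ h
    obtain ⟨m, ⟨e⟩⟩ := exists_linearEquiv hcomp τ.1
    obtain ⟨m', ⟨e'⟩⟩ := exists_linearEquiv hcomp τ'.1
    obtain rfl : m = m' := funext fun i => by
      rw [← mult_eq hirr hinj e, ← mult_eq hirr hinj e']
      exact congrFun (congrArg Subtype.val h) i
    exact Quotient.sound ((iso_iff _ _).2 ⟨e.trans e'.symm⟩)
  · rintro ⟨m, hm⟩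
    obtain ⟨τ, ⟨e⟩⟩ := exists_mod_linearEquiv (F := F) (G := G) (Π x : Σ i, Fin (m i), (σ x.1).Mod)
    exact ⟨Quotient.mk _ ⟨τ, (degree_eq_sum e).symm.trans hm⟩,
      Subtype.ext (funext fun i => mult_eq hirr hinj e i)⟩

/-- The squares of the degrees of pairwise non-isomorphic irreducible representations add up to at
most the order of the group. -/
theorem sum_degree_sq_le (hirr : ∀ i, (σ i).Irreducible)
    (hinj : ∀ i j, (σ i).Iso (σ j) → i = j) : ∑ i, (σ i).degree ^ 2 ≤ Nat.card G := by
  have _ (i : ι) : IsSimpleModule (MonoidAlgebra F G) (σ i).Mod := (irreducible_iff _).1 (hirr i)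
  have := Fintype.ofFinite G
  have := sum_finrank_sq_le F (fun i => (σ i).Mod) (A := MonoidAlgebra F G)
    (fun i j h => hinj i j ((iso_iff _ _).2 h))
  simp only [finrank_mod] at this
  rwa [(MonoidAlgebra.coeffLinearEquiv F (M := G) (S := F)).finrank_eq, finrank_finsupp_self,
    Fintype.card_eq_nat_card] at this

end Classification

end FinRep

/-! ### Counting multiplicities -/

/-- Stars and bars. -/
theorem finite_and_card_sum_eq (ι : Type*) [Fintype ι] (n : ℕ) : Finite {m : ι → ℕ // ∑ i, m i = n} ∧
    Nat.card {m : ι → ℕ // ∑ i, m i = n} = (Fintype.card ι + n - 1).choose n := by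
  classical
  let e := Sym.equivNatSumOfFintype ι n
  exact ⟨.of_equiv _ e, by
    rw [← Nat.card_congr e, Nat.card_eq_fintype_card, Sym.card_sym_eq_choose]⟩

/-- Solutions of `m₁ + ... + mₖ + 2 s = n`, sorted by `s`. -/
def sumTwiceEquiv {ι : Type*} [Fintype ι] (n : ℕ) :
    {m : Option ι → ℕ // ∑ i, m (some i) + 2 * m none = n} ≃
      Σ s : Fin (n / 2 + 1), {m : ι → ℕ // ∑ i, m i = n - 2 * s} where
  -- The bound s ≤ n / 2 keeps the subtraction n - 2s from truncating.
  toFun m := ⟨⟨m.1 none, by have := m.2; lia⟩, fun i => m.1 (some i), by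
    have := m.2
    dsimp only
    lia⟩
  invFun x := ⟨fun i => i.elim x.1 x.2.1, by
    have := x.2.2
    have := x.1.2
    simp only [Option.elim]
    lia⟩
  left_inv m := by
    ext i
    cases i <;> rfl
  right_inv x := rfl

/-! ### Abelianization and linear characters -/

/-- The centre Z of a 2-group is nontrivial and G/Z is not cyclic, so |Z| = 2 and |G/Z| = 4. Groups
of order p² are abelian, so the nontrivial commutator subgroup lies in Z and has order 2. -/
theorem card_abelianization_of_card_eight {G : Type*} [Group G] (hG : Nat.card G = 8)
    (hcomm : ¬ ∀ a b : G, a * b = b * a) : Nat.card (Abelianization G) = 4 := by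
  have : Finite G := Nat.finite_of_card_ne_zero (by simp [hG])
  have h2 : Fact (Nat.Prime 2) := ⟨Nat.prime_two⟩
  have hnc : ¬ IsMulCommutative G := fun h => hcomm h.is_comm.comm
  have hp : IsPGroup 2 G := .of_card (n := 3) (by simp [hG])
  have : Nontrivial G := Finite.one_lt_card_iff_nontrivial.1 (by simp [hG])
  have hZ : 1 < Nat.card (Subgroup.center G) :=
    Finite.one_lt_card_iff_nontrivial.2 hp.center_nontrivial
  have hmul := (Subgroup.center G).card_eq_card_quotient_mul_card_subgroup
  have hQ : ¬ Nat.card (G ⧸ Subgroup.center G) ∣ 2 := fun h => by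
    have := isCyclic_of_card_dvd_prime h
    exact hnc (isMulCommutative_of_isCyclic_quotient_center_self G)
  rw [hG] at hmul
  have hQ8 : Nat.card (G ⧸ Subgroup.center G) ≤ 8 := Nat.le_of_dvd (by simp) ⟨_, hmul⟩
  have hcard : Nat.card (G ⧸ Subgroup.center G) = 2 ^ 2 ∧ Nat.card (Subgroup.center G) = 2 := by
    generalize Nat.card (G ⧸ Subgroup.center G) = a at *
    generalize Nat.card (Subgroup.center G) = b at *
    interval_cases a <;> lia
  have hle : commutator G ≤ Subgroup.center G :=
    Subgroup.Normal.quotient_commutative_iff_commutator_le.1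
      (IsPGroup.isMulCommutative_of_card_eq_prime_sq hcard.1)
  have hdvd := Subgroup.card_dvd_of_le hle
  have hne : Nat.card (commutator G) ≠ 1 := fun h =>
    hnc ((commutator_eq_bot_iff G).1 (Subgroup.card_eq_one.1 h))
  rw [hcard.2, Nat.dvd_prime Nat.prime_two] at hdvd
  have hmul' := (commutator G).card_eq_card_quotient_mul_card_subgroup
  rw [hG, hdvd.resolve_left hne] at hmul'
  change Nat.card (G ⧸ commutator G) = 4
  lia

/-- Characters factor through the abelianization, whose exponent is invertible in `F`; so `F` has
enough roots of unity for duality of finite abelian groups. -/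
theorem card_monoidHom_units {F G : Type*} [Field F] [IsAlgClosed F] [Group G] [Finite G]
    [NeZero (Nat.card G : F)] : Nat.card (G →* Fˣ) = Nat.card (Abelianization G) := by
  have hdvd : Monoid.exponent (Abelianization G) ∣ Nat.card G :=
    Group.exponent_dvd_nat_card.trans (Subgroup.card_quotient_dvd_card (commutator G))
  have : NeZero (Monoid.exponent (Abelianization G) : F) := ⟨fun h => NeZero.ne (Nat.card G : F) (by
    obtain ⟨k, hk⟩ := hdvd
    rw [hk, Nat.cast_mul, h, zero_mul])⟩
  rw [Nat.card_congr Abelianization.lift]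
  exact CommGroup.card_monoidHom_of_hasEnoughRootsOfUnity (Abelianization G) F

/-! ### Degree one representations and completeness -/

namespace FinRep
variable {F : Type u} {G : Type v} [Field F] [Group G]

/-- The representation of degree one attached to a linear character. -/
noncomputable def ofChar (χ : G →* Fˣ) : FinRep F G where
  V := F
  ρ := (MonoidHomClass.toMonoidHom (Algebra.lmul F F)).comp ((Units.coeHom F).comp χ)

theorem degree_ofChar (χ : G →* Fˣ) : (ofChar χ).degree = 1 := finrank_self F

theorem irreducible_of_degree_eq_one {σ : FinRep F G} (h : σ.degree = 1) : σ.Irreducible := by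
  rw [irreducible_iff, isSimpleModule_iff]
  exact is_simple_module_of_finrank_eq_one (K := F) (by rw [finrank_mod, h])

theorem ofChar_iso {χ ψ : G →* Fˣ} (h : (ofChar χ).Iso (ofChar ψ)) : χ = ψ := by
  obtain ⟨e⟩ := h
  ext g
  let w : (ofChar χ).V := (1 : F)
  have h1 : e ((ofChar χ).ρ g w) = (ofChar ψ).ρ g (e w) :=
    e.toIntertwiningMap.isIntertwining (ofChar χ).ρ (ofChar ψ).ρ g w
  have h2 : e ((ofChar χ).ρ g w) = (χ g : F) • e w := map_smul e (χ g : F) w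
  have h3 : e w ≠ 0 := fun h =>
    one_ne_zero (α := F) (e.toLinearEquiv.injective (h.trans (map_zero e.toLinearEquiv).symm))
  rw [h2] at h1
  exact mul_right_cancel₀ (M₀ := F) h3 h1

theorem Irreducible.degree_pos {σ : FinRep F G} (h : σ.Irreducible) : 0 < σ.degree := by
  have := (irreducible_iff σ).1 h
  have := IsSimpleModule.nontrivial (MonoidAlgebra F G) σ.Mod
  rw [← finrank_mod]
  exact finrank_pos

section

variable [Finite G] [NeZero (Nat.card G : F)]

/-- If all irreducible representations have degree one, then the group is commutative. -/
theorem mul_comm_of_degree_eq_one (h : ∀ σ : FinRep F G, σ.Irreducible → σ.degree = 1) (a b : G) :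
    a * b = b * a := by
  obtain ⟨n, T, ⟨e⟩, hT⟩ := exists_linearEquiv_pi_simple F (A := MonoidAlgebra F G) (MonoidAlgebra F G)
  have hc (j : Fin n) (x : T j) : of F G a • of F G b • x = of F G b • of F G a • x := by
    have : FiniteDimensional F (T j) :=
      .of_injective ((T j).subtype.restrictScalars F) Subtype.val_injective
    obtain ⟨σ, ⟨f⟩⟩ := exists_mod_linearEquiv (F := F) (G := G) (T j)
    have hd : finrank F (T j) = 1 := by
      rw [← (f.restrictScalars F).finrank_eq, finrank_mod]
      exact h σ ((irreducible_iff σ).2 (.congr f))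
    -- On a line, `a` acts as a scalar and so commutes with `b`.
    obtain ⟨c, hc, -⟩ := LinearMap.existsUnique_eq_smul_id_of_finrank_eq_one hd
      (Algebra.lsmul F F (T j) (of F G a))
    have hac (y : T j) : of F G a • y = c • y := congr($hc y)
    rw [hac, hac, smul_algebra_smul_comm]
  have he (a b : G) : e (of F G (a * b)) = of F G a • of F G b • e 1 := by
    rw [← map_smul, ← map_smul, smul_eq_mul, smul_eq_mul, mul_one, map_mul]
  have : of F G (a * b) = of F G (b * a) := e.injective (by
    rw [he, he]
    exact funext fun j => hc j (e 1 j))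
  exact of_injective this

variable [IsAlgClosed F]

/-- Pairwise non-isomorphic irreducible representations whose squared degrees add up to the order
of the group form a complete family. -/
theorem exists_iso_of_sum_degree_sq {ι : Type*} [Fintype ι] {σ : ι → FinRep F G}
    (hirr : ∀ i, (σ i).Irreducible) (hinj : ∀ i j, (σ i).Iso (σ j) → i = j)
    (hsum : ∑ i, (σ i).degree ^ 2 = Nat.card G) (τ : FinRep F G) (hτ : τ.Irreducible) :
    ∃ i, τ.Iso (σ i) := by
  by_contra! hn
  -- Adjoining `τ` to the family would push the sum of squares past |G|.
  have := sum_degree_sq_le (σ := fun o : Option ι => o.elim τ σ) (by rintro (_ | i) <;> simp [*])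
    (by
      rintro (_ | i) (_ | j) hij
      · rfl
      · exact (hn j hij).elim
      · exact (hn i ⟨hij.some.symm⟩).elim
      · exact congrArg some (hinj i j hij))
  have hpos := hτ.degree_pos
  simp only [Fintype.sum_option, Option.elim, hsum] at this
  have : 0 < τ.degree ^ 2 := by positivity
  lia

end

end FinRep

/-! ### The two cases for groups of order eight -/

/-- Counting the multiplicities when all degrees are one. -/
theorem card_solutions {ι : Type*} [Fintype ι] {α : Type*} {d : ι → ℕ} {n : ℕ} (hd : ∀ i, d i = 1)
    (e : Nonempty (α ≃ {m : ι → ℕ // ∑ i, m i * d i = n})) :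
    Finite α ∧ Nat.card α = (Fintype.card ι + n - 1).choose n := by
  obtain ⟨e⟩ := e
  simp only [hd, mul_one] at e
  have := finite_and_card_sum_eq ι n
  exact ⟨have := this.1; .of_equiv _ e.symm, (Nat.card_congr e).trans this.2⟩

/-- Counting the multiplicities when one degree is two and all others are one. -/
theorem card_solutions_two {ι : Type*} [Fintype ι] {α : Type*} {d : Option ι → ℕ} {n : ℕ}
    (hd : ∀ i, d (some i) = 1) (hd' : d none = 2)
    (e : Nonempty (α ≃ {m : Option ι → ℕ // ∑ i, m i * d i = n})) :
    Finite α ∧ Nat.card α =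
      ∑ s ∈ Finset.range (n / 2 + 1), (Fintype.card ι + (n - 2 * s) - 1).choose (n - 2 * s) := by
  obtain ⟨e⟩ := e
  have hf (k : ℕ) : Finite {m : ι → ℕ // ∑ i, m i = k} := (finite_and_card_sum_eq ι k).1
  have e' := e.trans ((Equiv.subtypeEquivRight fun m => by
    rw [Fintype.sum_option, hd', mul_comm, add_comm]
    simp only [hd, mul_one]).trans (sumTwiceEquiv n))
  refine ⟨.of_equiv _ e'.symm, ?_⟩
  rw [Nat.card_congr e', Nat.card_sigma, Finset.sum_range]
  simp only [(finite_and_card_sum_eq ι _).2]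

/-- A non-commutative group of order eight has a complete family of irreducible representations of
degrees one, one, one, one and two. -/
theorem exists_irreducibles_of_card_eight {F : Type u} [Field F] [IsAlgClosed F] {G : Type v}
    [Group G] [Finite G] [NeZero (Nat.card G : F)] (hG : Nat.card G = 8)
    (hcomm : ¬ ∀ a b : G, a * b = b * a) :
    ∃ σ : Option (Fin 4) → FinRep F G, (∀ i, (σ i).Irreducible) ∧
      (∀ i, (σ (some i)).degree = 1) ∧ (σ none).degree = 2 ∧
      (∀ i j, (σ i).Iso (σ j) → i = j) ∧ ∀ τ : FinRep F G, τ.Irreducible → ∃ i, τ.Iso (σ i) := by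
  have hcard : Nat.card (G →* Fˣ) = 4 :=
    card_monoidHom_units.trans (card_abelianization_of_card_eight hG hcomm)
  have : Finite (G →* Fˣ) := Nat.finite_of_card_ne_zero (by simp [hcard])
  let χ : Fin 4 ≃ (G →* Fˣ) := (Finite.equivFinOfCardEq hcard).symm
  obtain ⟨ω, hω, hdeg⟩ : ∃ ω : FinRep F G, ω.Irreducible ∧ ω.degree ≠ 1 := by
    by_contra! h
    exact hcomm (FinRep.mul_comm_of_degree_eq_one h)
  let σ (o : Option (Fin 4)) : FinRep F G := o.elim ω fun i => .ofChar (χ i)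
  have hsome (i) : (σ (some i)).degree = 1 := FinRep.degree_ofChar _
  have hirr : ∀ i, (σ i).Irreducible := by
    rintro (_ | i)
    · exact hω
    · exact FinRep.irreducible_of_degree_eq_one (hsome i)
  have hinj : ∀ i j, (σ i).Iso (σ j) → i = j := by
    rintro (_ | i) (_ | j) h
    · rfl
    · exact (hdeg (h.degree_eq.trans (hsome j))).elim
    · exact (hdeg (h.degree_eq.symm.trans (hsome i))).elim
    · exact congrArg some (χ.injective (FinRep.ofChar_iso h))
  have hle := FinRep.sum_degree_sq_le hirr hinj
  have hpos := hω.degree_pos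
  have htwo : (σ none).degree = 2 := by
    change ω.degree = 2
    rw [Fintype.sum_option, hG] at hle
    simp only [hsome] at hle
    change ω.degree ^ 2 + _ ≤ 8 at hle
    have : ω.degree < 3 := by
      by_contra! h
      have := Nat.pow_le_pow_left h 2
      simp at hle
      lia
    lia
  exact ⟨σ, hirr, hsome, htwo, hinj, FinRep.exists_iso_of_sum_degree_sq hirr hinj (by
    simp [Fintype.sum_option, hsome, htwo, hG])⟩

theorem theorem1p1 {F : Type u} [Field F] [IsAlgClosed F] (hF : ringChar F ≠ 2)
    {G : Type v} [Group G] (hG : Nat.card G = 8) :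
    ((∀ a b : G, a * b = b * a) →
      ∀ n : ℕ, Finite (FinRep.IsoClasses F G n) ∧
        Nat.card (FinRep.IsoClasses F G n) = (n + 7).choose 7) ∧
    ((¬ ∀ a b : G, a * b = b * a) →
      (∀ n : ℕ, Finite (FinRep.IsoClasses F G n) ∧
        Nat.card (FinRep.IsoClasses F G n) =
          ∑ s ∈ Finset.range (n / 2 + 1), (n - 2 * s + 3).choose 3) ∧
      ∃ σ : Fin 5 → FinRep F G,
        (∀ i, (σ i).Irreducible) ∧
        (∀ i, (σ i).degree = (![1, 1, 1, 1, 2] : Fin 5 → ℕ) i) ∧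
        (∀ i j, (σ i).Iso (σ j) → i = j) ∧
        ∀ τ : FinRep F G, τ.Irreducible → ∃ i, τ.Iso (σ i)) := by
  have : Finite G := Nat.finite_of_card_ne_zero (by simp [hG])
  have : NeZero (Nat.card G : F) := ⟨by
    have h2 : (2 : F) ≠ 0 := Ring.two_ne_zero hF
    rw [hG, show ((8 : ℕ) : F) = 2 ^ 3 by norm_num]
    exact pow_ne_zero 3 h2⟩
  refine ⟨fun hcomm n => ?_, fun hcomm => ?_⟩
  · have hcard : Nat.card (G →* Fˣ) = 8 := by
      have : commutator G = ⊥ := (commutator_eq_bot_iff G).2 ⟨⟨hcomm⟩⟩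
      have hmul := (commutator G).card_eq_card_quotient_mul_card_subgroup
      rw [hG, Subgroup.card_eq_one.2 this, mul_one] at hmul
      exact card_monoidHom_units.trans hmul.symm
    have : Finite (G →* Fˣ) := Nat.finite_of_card_ne_zero (by simp [hcard])
    have := Fintype.ofFinite (G →* Fˣ)
    have hirr (χ : G →* Fˣ) := FinRep.irreducible_of_degree_eq_one (FinRep.degree_ofChar χ)
    have hinj (χ ψ : G →* Fˣ) := FinRep.ofChar_iso (χ := χ) (ψ := ψ)
    have hcomp := FinRep.exists_iso_of_sum_degree_sq hirr hinj (by
      simp [FinRep.degree_ofChar, hG, ← Nat.card_eq_fintype_card, hcard])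
    obtain ⟨h₁, h₂⟩ := card_solutions FinRep.degree_ofChar
      (FinRep.nonempty_isoClasses_equiv hirr hinj hcomp n)
    refine ⟨h₁, h₂.trans ?_⟩
    rw [Fintype.card_eq_nat_card, hcard, show 8 + n - 1 = n + 7 by lia, Nat.choose_symm_add]
  · obtain ⟨σ, hirr, hone, htwo, hinj, hcomp⟩ := exists_irreducibles_of_card_eight (F := F) hG hcomm
    -- `finSuccEquivLast` sends the last index to `none`, which puts degree 2 at the end.
    refine ⟨fun n => ?_, σ ∘ finSuccEquivLast, fun i => hirr _, fun i => ?_,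
      fun i j h => finSuccEquivLast.injective (hinj _ _ h), fun τ hτ => ?_⟩
    · obtain ⟨h₁, h₂⟩ := card_solutions_two hone htwo
        (FinRep.nonempty_isoClasses_equiv hirr hinj hcomp n)
      refine ⟨h₁, h₂.trans (Finset.sum_congr rfl fun s _ => ?_)⟩
      rw [Fintype.card_fin, show 4 + (n - 2 * s) - 1 = n - 2 * s + 3 by lia, Nat.choose_symm_add]
    · induction i using Fin.lastCases with
      | last =>
        rw [Function.comp_apply, finSuccEquivLast_last, htwo]
        rfl
      | cast i =>
        rw [Function.comp_apply, finSuccEquivLast_castSucc, hone]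
        fin_cases i <;> rfl
    · obtain ⟨i, hi⟩ := hcomp τ hτ
      exact ⟨finSuccEquivLast.symm i, by simpa using hi⟩
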